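/- Let $n,k\ge 0$ be integers, let $U\subset\mathbb R^n$ be open, and let $\omega$ be a differential $k$-form on $U$, that is, an arbitrary function $\omega:U\to\Lambda^k(\mathbb R^n)^*$. **Definitions.** For $m\ge 1$, an $m$-block is a product $B=\prod_{i=1}^m[a_{i0},a_{i1}]\subset\mathbb R^m$ with $a_{i0}<a_{i1}$ for all $i$; the $0$-block is the one-point space $\mathbb R^0$. A singular $m$-block of class $C^1$ in $U$ is a map $c:B\to U$ on an $m$-block $B$ which near each point of $B$ is the restriction of an $\mathbb R^n$-valued $C^1$ map defined on an open subset of $\mathbb R^m$. An $m$-chain of class $C^1$ in $U$ is a formal finite sum $n_1c_1+\dots+n_lc_l$ of such singular $m$-blocks with $n_i\in\mathbb Z$. For $m\ge1$ the boundary of a singular $m$-block $c$ is the $(m-1)$-chain $$\partial c=\sum_{i=1}^{m}\sum_{j=0}^{1}(-1)^{i+j}c_{ij},\qquad c_{ij}(t_1,\dots,\widehat{t_i},\dots,t_m)=c(t_1,\dots,a_{ij},\dots,t_m),$$ and $\partial(n_1c_1+\dots+n_lc_l)=n_1\partial c_1+\dots+n_l\partial c_l$. For a singular $m$-block $c:B\to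 U$ and an $m$-form $\eta$, write $c^*\eta=f\,\mathrm dx^1\wedge\dots\wedge\mathrm dx^m$ and put $\int_c\eta=\int_Bf$ (Riemann integral) when this exists; for $m=0$ this is the value of $\eta$ at the point $c$. If $\eta$ is given only on $c(\mathring B)$, then $\int_c\eta$ is the Riemann integral over $B$ of an extension of $f|_{\mathring B}$ to $B$, when there is a Riemann integrable one (its integral does not depend on the extension). For chains, $\int_{n_1c_1+\dots+n_lc_l}\eta=\sum_i n_i\int_{c_i}\eta$ when all the integrals on the right exist. Where $\omega$ is differentiable, $$\mathrm d\omega_x(v_1,\dots,v_{k+1})=\sum_{i=1}^{k+1}(-1)^{i+1}\,(\omega'(x)v_i)(v_1,\dots,\widehat{v_i},\dots,v_{k+1}).$$ **Theorem (Stokes without $C^1$ assumption).** Let $c:B\to U$ be a singular $(k+1)$-block of class $C^1$. If the restriction of $\omega$ to $c(B)$ is continuous and $\omega$ is differentiable at every point of $c(\mathring B)$, then, whenever $\int_c\mathrm d\omega$ exists, $\int_{\partial c}\omega$ exists and $$\int_{\partial c}\omega=\int_c\mathrm d\omega.$$ More generally, let $c=n_1c_1+\dots+n_lc_l$ be a $(k+1)$-chain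 of class $C^1$ with $c_i:B_i\to U$ distinct and $n_i\neq0$. If for each $i$ the restriction of $\omega$ to $c_i(B_i)$ is continuous and $\omega$ is differentiable at every point of $c_i(\mathring B_i)$, then the same conclusion holds for $c$. -/

import Mathlib

open scoped BigOperators

noncomputable section

namespace Stokes

/-- Class `C¹` for a function on an arbitrary subset `X` of a normed space: near each point of `X`
the function is the restriction of a `C¹` function defined on an open neighbourhood. -/
def IsC1On {E F : Type*} [NormedAddCommGroup E] [NormedSpace ℝ E] [NormedAddCommGroup F]
    [NormedSpace ℝ F] (f : E → F) (X : Set E) : Prop :=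
  ∀ x ∈ X, ∃ V : Set E, IsOpen V ∧ x ∈ V ∧
    ∃ G : E → F, ContDiffOn ℝ 1 G V ∧ ∀ y ∈ V ∩ X, f y = G y

/-- A differential `m`-form on (a subset of) `ℝⁿ`, without any regularity. For a form on an open
set `U` only the values on `U` matter. -/
abbrev Form (n m : ℕ) : Type :=
  EuclideanSpace ℝ (Fin n) → EuclideanSpace ℝ (Fin n) [⋀^Fin m]→L[ℝ] ℝ

/-- A singular `k`-block of class `C¹` in `U ⊆ ℝⁿ`: a nondegenerate closed block
`box.Icc = ∏ i, [box.lower i, box.upper i]` and a `C¹` map from it to `U`. The map is stored as a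
total function with value `0` off the block, so that a singular block is determined by its block
and by its values there. For `k = 0` the block is the one-point space. -/
structure SingularBlock {n : ℕ} (k : ℕ) (U : Set (EuclideanSpace ℝ (Fin n))) where
  box : BoxIntegral.Box (Fin k)
  toFun : (Fin k → ℝ) → EuclideanSpace ℝ (Fin n)
  mapsTo : Set.MapsTo toFun (BoxIntegral.Box.Icc box) U
  isC1On : IsC1On toFun (BoxIntegral.Box.Icc box)
  eq_zero : ∀ t, t ∉ BoxIntegral.Box.Icc box → toFun t = 0

/-- `k`-chains of class `C¹` in `U`: formal finite sums of singular `k`-blocks with integer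
coefficients. -/
abbrev Chain {n : ℕ} (k : ℕ) (U : Set (EuclideanSpace ℝ (Fin n))) : Type :=
  SingularBlock k U →₀ ℤ

variable {n k : ℕ} {U : Set (EuclideanSpace ℝ (Fin n))}

/-- The image `c(B)` of the closed block. -/
def SingularBlock.image (c : SingularBlock k U) : Set (EuclideanSpace ℝ (Fin n)) :=
  c.toFun '' BoxIntegral.Box.Icc c.box

/-- The image under `c` of the interior of the block. -/
def SingularBlock.interiorImage (c : SingularBlock k U) : Set (EuclideanSpace ℝ (Fin n)) :=
  c.toFun '' BoxIntegral.Box.Ioo c.box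

/-- The `i`-th coordinate of the lower (`j = 0`) or upper (`j = 1`) face of a block. -/
def endpoint (I : BoxIntegral.Box (Fin (k + 1))) (i : Fin (k + 1)) (j : Fin 2) : ℝ :=
  if j = 0 then I.lower i else I.upper i

theorem endpoint_mem (I : BoxIntegral.Box (Fin (k + 1))) (i : Fin (k + 1)) (j : Fin 2) :
    endpoint I i j ∈ Set.Icc (I.lower i) (I.upper i) := by
  unfold endpoint
  split_ifs
  · exact Set.left_mem_Icc.2 (I.lower_le_upper i)
  · exact Set.right_mem_Icc.2 (I.lower_le_upper i)

theorem insertNth_mem_Icc_iff (I : BoxIntegral.Box (Fin (k + 1))) (i : Fin (k + 1)) (j : Fin 2)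
    (t : Fin k → ℝ) :
    (i.insertNth (endpoint I i j) t : Fin (k + 1) → ℝ) ∈ BoxIntegral.Box.Icc I ↔
      t ∈ BoxIntegral.Box.Icc (I.face i) := by
  have h := endpoint_mem I i j
  simp only [BoxIntegral.Box.Icc_def, Set.mem_Icc, Fin.insertNth_le_iff, Fin.le_insertNth_iff]
  constructor
  · rintro ⟨⟨_, h1⟩, _, h2⟩
    exact ⟨h1, h2⟩
  · rintro ⟨h1, h2⟩
    exact ⟨⟨h.1, h1⟩, h.2, h2⟩

theorem contDiff_insertNth (i : Fin (k + 1)) (a : ℝ) :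
    ContDiff ℝ 1 (fun t : Fin k → ℝ => (i.insertNth a t : Fin (k + 1) → ℝ)) := by
  rw [contDiff_pi]
  intro l
  refine Fin.succAboveCases i ?_ (fun l => ?_) l
  · simpa using contDiff_const
  · simpa using contDiff_apply ℝ ℝ l

/-- The face `c_{ij}` of a singular block: the `i`-th variable is fixed at its lower (`j = 0`) or
upper (`j = 1`) endpoint. -/
def SingularBlock.face (c : SingularBlock (k + 1) U) (i : Fin (k + 1)) (j : Fin 2) :
    SingularBlock k U where
  box := c.box.face i
  toFun t := c.toFun (i.insertNth (endpoint c.box i j) t)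
  mapsTo t ht := c.mapsTo ((insertNth_mem_Icc_iff c.box i j t).2 ht)
  isC1On := by
    intro t ht
    obtain ⟨V, hV, htV, G, hG, hfG⟩ := c.isC1On _ ((insertNth_mem_Icc_iff c.box i j t).2 ht)
    have hι := contDiff_insertNth i (endpoint c.box i j)
    refine ⟨_, hV.preimage hι.continuous, htV, _,
      hG.comp hι.contDiffOn (Set.mapsTo_preimage _ _), ?_⟩
    rintro y ⟨hyV, hy⟩
    exact hfG _ ⟨hyV, (insertNth_mem_Icc_iff c.box i j y).2 hy⟩
  eq_zero t ht := c.eq_zero _ fun h => ht ((insertNth_mem_Icc_iff c.box i j t).1 h)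

/-- The boundary chain of a singular block. The sign is `(-1)^(i+j)` with `i` counted from `1`,
that is `(-1)^(i+1+j)` with `i : Fin (k + 1)` counted from `0`. -/
def SingularBlock.boundary (c : SingularBlock (k + 1) U) : Chain k U :=
  ∑ i : Fin (k + 1), ∑ j : Fin 2, Finsupp.single (c.face i j) ((-1 : ℤ) ^ ((i : ℕ) + 1 + (j : ℕ)))

/-- The boundary of a chain. -/
def Chain.boundary (c : Chain (k + 1) U) : Chain k U :=
  c.sum fun s m => m • s.boundary

/-- The pullback `c^* ω` of a form along a singular block, at a point of the block. -/
def SingularBlock.pullback {m : ℕ} (c : SingularBlock k U) (ω : Form n m) (t : Fin k → ℝ) :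
    (Fin k → ℝ) [⋀^Fin m]→L[ℝ] ℝ :=
  (ω (c.toFun t)).compContinuousLinearMap (fderivWithin ℝ c.toFun (BoxIntegral.Box.Icc c.box) t)

/-- The function `f` such that `c^* ω = f dx¹ ∧ ⋯ ∧ dxᵏ`. -/
def SingularBlock.coeff (c : SingularBlock k U) (ω : Form n k) (t : Fin k → ℝ) : ℝ :=
  c.pullback ω t fun i => Pi.single i 1

/-- The Riemann integral of a function over the closed block exists and equals `y`. -/
def HasRiemannIntegral (I : BoxIntegral.Box (Fin k)) (f : (Fin k → ℝ) → ℝ) (y : ℝ) : Prop :=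
  BoxIntegral.HasIntegral I BoxIntegral.IntegrationParams.Riemann f
    BoxIntegral.BoxAdditiveMap.volume y

/-- The integral of a `k`-form over a singular `k`-block exists and equals `y`. -/
def SingularBlock.HasIntegral (c : SingularBlock k U) (ω : Form n k) (y : ℝ) : Prop :=
  HasRiemannIntegral c.box (c.coeff ω) y

/-- The integral over a singular block `c` of a `k`-form `η` that is only given on the image of
the interior of the block: the boundary of the block being negligible for the Riemann integral,
the coefficient of `c^* η` may be extended to the boundary by any values for which the Riemann
integral over the closed block exists; it does not depend on them. -/
def SingularBlock.HasInteriorIntegral (c : SingularBlock k U) (η : Form n k) (y : ℝ) : Prop :=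
  ∃ g : (Fin k → ℝ) → ℝ, (∀ t ∈ BoxIntegral.Box.Ioo c.box, g t = c.coeff η t) ∧
    HasRiemannIntegral c.box g y

/-- `∫_c ω = n₁ ∫_{c₁} ω + ⋯ + n_p ∫_{c_p} ω` exists (each integral does) and equals `y`. -/
def Chain.HasIntegral (c : Chain k U) (ω : Form n k) (y : ℝ) : Prop :=
  ∃ v : SingularBlock k U → ℝ, (∀ s ∈ c.support, s.HasIntegral ω (v s)) ∧
    y = c.sum fun s m => (m : ℝ) * v s

/-- The same for a form that is only given on the images of the interiors of the blocks. -/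
def Chain.HasInteriorIntegral (c : Chain k U) (η : Form n k) (y : ℝ) : Prop :=
  ∃ v : SingularBlock k U → ℝ, (∀ s ∈ c.support, s.HasInteriorIntegral η (v s)) ∧
    y = c.sum fun s m => (m : ℝ) * v s

end Stokes

end

/-!
For a box `J` inside the block `B`, let `Φ(J)` be the flux through `∂J` of the vector field that
represents `c^* ω`; then `Φ(B)` is the integral of `ω` over `∂c`, and `Φ` is additive. Its
derivative at an interior point `p` is the coefficient of `c^* dω`: by linearity one may subtract
from `ω` the constant form `ω(c(p))`, which does not change `Φ` near `p`, and then `c^* ω` is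
differentiable at `p` although `c` is only `C¹`, because `ω` vanishes at `c(p)`. Pullbacks of
constant forms have flux `0` since this is `d² = 0` when the map is `C²`, and a `C¹` map is a `C¹`
limit of smooth ones. The Henstock integral recovers an additive box function from its derivative
on boxes contained in the interior of `B`, and these exhaust `B`; a Riemann integrable function
being bounded, the integrals converge along with the fluxes.
-/

noncomputable section

namespace Stokes

open Set Filter Topology BoxIntegral
open MeasureTheory (Measure volume)
open BoxIntegral.IntegrationParams (GP Riemann gp_le)
open scoped BoxIntegral NNReal Convolution Manifold

section BoxIntegral

variable {ι E : Type*} {I J : Box ι}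

theorem closure_coe_box (I : Box ι) : closure (I : Set (ι → ℝ)) = Box.Icc I := by
  simp [Box.coe_eq_pi, Box.Icc_eq_pi, closure_pi_set, I.lower_ne_upper]

theorem Icc_subset_biUnion_Icc {π : Prepartition I} (hπ : π.IsPartition) :
    Box.Icc I ⊆ ⋃ J ∈ π.boxes, Box.Icc J := by
  rw [← closure_coe_box I]
  refine closure_minimal ?_ <|
    π.boxes.finite_toSet.isClosed_biUnion fun J _ => J.isCompact_Icc.isClosed
  rw [← hπ.iUnion_eq]
  exact iUnion₂_mono fun J _ => Box.coe_subset_Icc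

theorem sub_eq_sum_compl_single [Finite ι] {M : Type*} [AddCommGroup M] (A : ι →ᵇᵃ[I] M)
    (hJ : J ≤ I) :
    A I - A J = ∑ K ∈ (Prepartition.single I J hJ).compl.boxes, A K := by
  classical
  set π := Prepartition.single I J hJ
  have hdisj : Disjoint π.iUnion π.compl.iUnion := by
    rw [Prepartition.iUnion_compl]
    exact disjoint_sdiff_self_right
  have hpart : (π.disjUnion π.compl hdisj).IsPartition :=
    Prepartition.isPartitionDisjUnionOfEqDiff π.iUnion_compl
  rw [← A.sum_partition_boxes le_rfl hpart, Prepartition.disjUnion_boxes,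
    Prepartition.sum_disj_union_boxes hdisj]
  simp [π]

variable [Fintype ι] [NormedAddCommGroup E] [NormedSpace ℝ E] {f g : (ι → ℝ) → E}
  {l : IntegrationParams}

theorem volume_real_box (I : Box ι) :
    volume.real (I : Set (ι → ℝ)) = ∏ i, (I.upper i - I.lower i) :=
  Box.volume_apply' I

theorem volume_real_box_pos (I : Box ι) : 0 < volume.real (I : Set (ι → ℝ)) := by
  rw [volume_real_box]
  exact Finset.prod_pos fun i _ => sub_pos.2 (I.lower_lt_upper i)

theorem volume_real_box_mono (h : J ≤ I) :
    volume.real (J : Set (ι → ℝ)) ≤ volume.real (I : Set (ι → ℝ)) :=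
  MeasureTheory.measureReal_mono (Box.coe_subset_coe.2 h) (I.measure_coe_lt_top volume).ne

theorem integral_congr_of_eqOn_Icc (h : EqOn f g (Box.Icc I)) :
    integral I l f BoxAdditiveMap.volume = integral I l g BoxAdditiveMap.volume := by
  have hfg (y : E) : HasIntegral I l f BoxAdditiveMap.volume y ↔
      HasIntegral I l g BoxAdditiveMap.volume y := hasIntegral_congr I l h (fun _ _ => rfl) y
  by_cases hg : Integrable I l g BoxAdditiveMap.volume
  · exact ((hfg _).2 hg.hasIntegral).integral_eq
  · have hf : ¬Integrable I l f BoxAdditiveMap.volume := fun hf => hg (hf.imp fun y => (hfg y).1)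
    rw [integral, integral, dif_neg hf, dif_neg hg]

theorem norm_le_of_Icc_subset_closedBall_convergenceR [CompleteSpace E]
    (hg : Integrable I Riemann g BoxAdditiveMap.volume) (hJ : J ≤ I) {x : ι → ℝ}
    (hx : x ∈ Box.Icc J) (hsub : Box.Icc J ⊆ Metric.closedBall x (hg.convergenceR 1 0 x)) :
    ‖g x‖ ≤ (1 + ‖integral J Riemann g BoxAdditiveMap.volume‖) /
      volume.real (J : Set (ι → ℝ)) := by
  have hxI : x ∈ Box.Icc I := Box.le_iff_Icc.1 hJ hx
  have hbase : Riemann.MemBaseSet I 0 (hg.convergenceR 1 0)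
      (TaggedPrepartition.single I J hJ x hxI) :=
    ⟨(TaggedPrepartition.isSubordinate_single hJ hxI).2 hsub,
      fun _ => (TaggedPrepartition.isHenstock_single_iff hJ hxI).2 hx,
      fun h => (Bool.false_ne_true h).elim, fun h => (Bool.false_ne_true h).elim⟩
  have henstockSacks : ‖volume.real (J : Set (ι → ℝ)) • g x -
      integral J Riemann g BoxAdditiveMap.volume‖ ≤ 1 := by
    have := hg.dist_integralSum_sum_integral_le_of_memBaseSet one_pos hbase
    simpa [integralSum, dist_eq_norm, volume_real_box, BoxAdditiveMap.volume_apply,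
      TaggedPrepartition.single] using this
  rw [le_div_iff₀' (volume_real_box_pos J)]
  calc volume.real (J : Set (ι → ℝ)) * ‖g x‖ = ‖volume.real (J : Set (ι → ℝ)) • g x‖ := by
        rw [norm_smul, Real.norm_of_nonneg (volume_real_box_pos J).le]
    _ ≤ 1 + ‖integral J Riemann g BoxAdditiveMap.volume‖ := by
        rw [← sub_le_iff_le_add]
        exact (norm_sub_norm_le _ _).trans henstockSacks

theorem exists_norm_le_of_integrable_Riemann [CompleteSpace E]
    (hg : Integrable I Riemann g BoxAdditiveMap.volume) : ∃ M, ∀ x ∈ Box.Icc I, ‖g x‖ ≤ M := by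
  let r := hg.convergenceR 1 0
  have hr (x) : (r x : ℝ) = r 0 := congrArg _ (hg.convergenceR_cond 1 0 rfl x)
  obtain ⟨π, hπ, -, hsub, -⟩ :=
    Box.exists_taggedPartition_isHenstock_isSubordinate_homothetic I
      fun _ => ⟨(r 0 : ℝ) / 2, half_pos (show (0 : ℝ) < r 0 from (r 0).2)⟩
  let M (J : Box ι) : ℝ := (1 + ‖integral J Riemann g BoxAdditiveMap.volume‖) /
    volume.real (J : Set (ι → ℝ))
  have bound_of_mem : ∀ J ∈ π.boxes, ∀ x ∈ Box.Icc J, ‖g x‖ ≤ M J := fun J hJ x hx => by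
    refine norm_le_of_Icc_subset_closedBall_convergenceR hg (π.le_of_mem hJ) hx fun z hz => ?_
    calc dist z x ≤ dist z (π.tag J) + dist x (π.tag J) := dist_triangle_right _ _ _
      _ ≤ r 0 / 2 + r 0 / 2 := add_le_add (hsub J hJ hz) (hsub J hJ hx)
      _ = r x := by rw [add_halves, hr x]
  refine ⟨∑ J ∈ π.boxes, M J, fun x hx => ?_⟩
  obtain ⟨J, hJ, hxJ⟩ := mem_iUnion₂.1 (Icc_subset_biUnion_Icc hπ hx)
  exact (bound_of_mem J hJ x hxJ).trans
    (Finset.single_le_sum (f := M) (fun J _ => by positivity) hJ)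

theorem norm_integral_sub_integral_le [CompleteSpace E]
    (hg : Integrable I l g BoxAdditiveMap.volume) {M : ℝ} (hM : ∀ x ∈ Box.Icc I, ‖g x‖ ≤ M)
    (hJ : J ≤ I) :
    ‖integral I l g BoxAdditiveMap.volume - integral J l g BoxAdditiveMap.volume‖ ≤
      (volume.real (I : Set (ι → ℝ)) - volume.real (J : Set (ι → ℝ))) * M := by
  have sum_integral : integral I l g BoxAdditiveMap.volume -
      integral J l g BoxAdditiveMap.volume =
        ∑ K ∈ (Prepartition.single I J hJ).compl.boxes, integral K l g BoxAdditiveMap.volume :=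
    sub_eq_sum_compl_single hg.toBoxAdditive hJ
  have sum_volume : volume.real (I : Set (ι → ℝ)) - volume.real (J : Set (ι → ℝ)) =
      ∑ K ∈ (Prepartition.single I J hJ).compl.boxes, volume.real (K : Set (ι → ℝ)) :=
    sub_eq_sum_compl_single ((volume : Measure (ι → ℝ)).toBoxAdditive.restrict _ le_top) hJ
  rw [sum_integral, sum_volume, Finset.sum_mul]
  exact norm_sum_le_of_le _ fun K hK => norm_integral_le_of_le_const
    (fun x hx => hM x (Box.le_iff_Icc.1 (Prepartition.le_of_mem _ hK) hx)) volume

variable {α : Type*} {L : Filter α} {B : α → Box ι}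

theorem tendsto_volume_real_box (hlower : Tendsto (fun a => (B a).lower) L (𝓝 I.lower))
    (hupper : Tendsto (fun a => (B a).upper) L (𝓝 I.upper)) :
    Tendsto (fun a => volume.real (B a : Set (ι → ℝ))) L (𝓝 (volume.real (I : Set (ι → ℝ)))) := by
  simp only [volume_real_box]
  rw [tendsto_pi_nhds] at hlower hupper
  exact tendsto_finsetProd _ fun i _ => (hupper i).sub (hlower i)

theorem tendsto_integral_subbox [CompleteSpace E]
    (hg : Integrable I l g BoxAdditiveMap.volume) {M : ℝ} (hM : ∀ x ∈ Box.Icc I, ‖g x‖ ≤ M)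
    (hB : ∀ a, B a ≤ I) (hlower : Tendsto (fun a => (B a).lower) L (𝓝 I.lower))
    (hupper : Tendsto (fun a => (B a).upper) L (𝓝 I.upper)) :
    Tendsto (fun a => integral (B a) l g BoxAdditiveMap.volume) L
      (𝓝 (integral I l g BoxAdditiveMap.volume)) := by
  have hvol := ((tendsto_const_nhds (x := volume.real (I : Set (ι → ℝ)))).sub
    (tendsto_volume_real_box hlower hupper)).mul_const M
  rw [sub_self, zero_mul] at hvol
  refine tendsto_iff_norm_sub_tendsto_zero.2 <| squeeze_zero_norm (fun a => ?_) hvol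
  rw [norm_norm, norm_sub_rev]
  exact norm_integral_sub_integral_le hg hM (hB a)

theorem tendsto_integral_of_tendstoUniformlyOn [CompleteSpace E] {f : α → (ι → ℝ) → E}
    (hf : ∀ a, Integrable I l (f a) BoxAdditiveMap.volume)
    (hg : Integrable I l g BoxAdditiveMap.volume) {M : ℝ} (hM : ∀ x ∈ Box.Icc I, ‖g x‖ ≤ M)
    (hlim : TendstoUniformlyOn f g L (Box.Icc I)) (hB : ∀ a, B a ≤ I)
    (hlower : Tendsto (fun a => (B a).lower) L (𝓝 I.lower))
    (hupper : Tendsto (fun a => (B a).upper) L (𝓝 I.upper)) :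
    Tendsto (fun a => integral (B a) l (f a) BoxAdditiveMap.volume) L
      (𝓝 (integral I l g BoxAdditiveMap.volume)) := by
  refine (tendsto_integral_subbox hg hM hB hlower hupper).congr_dist ?_
  refine Metric.tendsto_nhds.2 fun ε hε => ?_
  obtain ⟨δ, hδ, hlt⟩ := exists_pos_mul_lt hε (volume.real (I : Set (ι → ℝ)))
  filter_upwards [Metric.tendstoUniformlyOn_iff.1 hlim δ hδ] with a ha
  have hdist : ∀ x ∈ Box.Icc (B a), ‖(g - f a) x‖ ≤ δ := fun x hx => by
    rw [Pi.sub_apply, ← dist_eq_norm]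
    exact (ha x (Box.le_iff_Icc.1 (hB a) hx)).le
  calc dist (dist (integral (B a) l g BoxAdditiveMap.volume)
        (integral (B a) l (f a) BoxAdditiveMap.volume)) 0
      = ‖integral (B a) l (g - f a) BoxAdditiveMap.volume‖ := by
        rw [integral_sub (hg.to_subbox (hB a)) ((hf a).to_subbox (hB a)), dist_zero_right,
          Real.norm_of_nonneg dist_nonneg, dist_eq_norm]
    _ ≤ volume.real (B a : Set (ι → ℝ)) * δ := norm_integral_le_of_le_const hdist volume
    _ ≤ volume.real (I : Set (ι → ℝ)) * δ :=
        mul_le_mul_of_nonneg_right (volume_real_box_mono (hB a)) hδ.le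
    _ < ε := hlt

end BoxIntegral

theorem tendstoUniformlyOn_comp {α β γ δ : Type*} [UniformSpace γ] [UniformSpace δ] {L : Filter α}
    {F : α → γ → δ} {f : γ → δ} {Φ : α → β → γ} {φ : β → γ} {s : Set γ} {t : Set β}
    (hF : TendstoUniformlyOn F f L s) (hf : UniformContinuousOn f s)
    (hΦ : TendstoUniformlyOn Φ φ L t) (hΦs : ∀ a, MapsTo (Φ a) t s) (hφs : MapsTo φ t s) :
    TendstoUniformlyOn (fun a => F a ∘ Φ a) (f ∘ φ) L t := by
  intro u hu
  obtain ⟨v, hv, hvu⟩ := comp_mem_uniformity_sets hu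
  have hfΦ := hf.comp_tendstoUniformlyOn_eventually (.of_forall hΦs) hφs hΦ
  filter_upwards [hfΦ v hv, hF v hv] with a h₁ h₂ x hx
  exact hvu ⟨_, h₁ x hx, h₂ _ (hΦs a hx)⟩

section Flux

variable {m : ℕ} {F G : (Fin (m + 1) → ℝ) → Fin (m + 1) → ℝ} {I J : Box (Fin (m + 1))}

/-- The integral of the `i`-th component of a vector field over the lower (`j = 0`) or upper
(`j = 1`) face of a box orthogonal to the `i`-th axis. -/
def faceIntegral (F : (Fin (m + 1) → ℝ) → Fin (m + 1) → ℝ) (I : Box (Fin (m + 1)))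
    (i : Fin (m + 1)) (j : Fin 2) : ℝ :=
  integral (I.face i) GP (fun x => F (i.insertNth (endpoint I i j) x) i) BoxAdditiveMap.volume

/-- The flux of a vector field through the boundary of a box, outward. -/
def flux (F : (Fin (m + 1) → ℝ) → Fin (m + 1) → ℝ) (I : Box (Fin (m + 1))) : ℝ :=
  ∑ i, (faceIntegral F I i 1 - faceIntegral F I i 0)

theorem endpoint_mem_of_le (h : J ≤ I) (i : Fin (m + 1)) (j : Fin 2) :
    endpoint J i j ∈ Icc (I.lower i) (I.upper i) := by
  have := Box.le_iff_bounds.1 h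
  exact ⟨(this.1 i).trans (endpoint_mem J i j).1, (endpoint_mem J i j).2.trans (this.2 i)⟩

theorem integrable_face (hF : ContinuousOn F (Box.Icc I)) (i : Fin (m + 1)) {z : ℝ}
    (hz : z ∈ Icc (I.lower i) (I.upper i)) (l : IntegrationParams) :
    Integrable (I.face i) l (fun x => F (i.insertNth z x) i) BoxAdditiveMap.volume :=
  integrable_of_continuousOn _
    (Box.continuousOn_face_Icc ((continuous_apply i).comp_continuousOn hF) hz) volume

theorem faceIntegral_sub (hF : ContinuousOn F (Box.Icc I)) (hG : ContinuousOn G (Box.Icc I))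
    (i : Fin (m + 1)) (j : Fin 2) :
    faceIntegral (F - G) I i j = faceIntegral F I i j - faceIntegral G I i j :=
  integral_sub (integrable_face hF i (endpoint_mem I i j) GP)
    (integrable_face hG i (endpoint_mem I i j) GP)

theorem flux_sub (hF : ContinuousOn F (Box.Icc I)) (hG : ContinuousOn G (Box.Icc I)) :
    flux (F - G) I = flux F I - flux G I := by
  simp only [flux, faceIntegral_sub hF hG, ← Finset.sum_sub_distrib]
  exact Finset.sum_congr rfl fun i _ => sub_sub_sub_comm ..

theorem flux_congr (h : EqOn F G (Box.Icc I)) : flux F I = flux G I :=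
  Finset.sum_congr rfl fun i _ => congrArg₂ _
    (integral_congr_of_eqOn_Icc fun _ hx => congrFun (h ((insertNth_mem_Icc_iff I i 1 _).2 hx)) i)
    (integral_congr_of_eqOn_Icc fun _ hx => congrFun (h ((insertNth_mem_Icc_iff I i 0 _).2 hx)) i)

theorem exists_boxAdditiveMap_eq_flux (hF : ContinuousOn F (Box.Icc I)) :
    ∃ A : Fin (m + 1) →ᵇᵃ[I] ℝ, ∀ J, A J = flux F J := by
  let sliceIntegral (i : Fin (m + 1)) (z : Icc (I.lower i) (I.upper i)) : Fin m →ᵇᵃ[I.face i] ℝ :=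
    (integrable_face hF i z.2 GP).toBoxAdditive
  let A (i : Fin (m + 1)) : Fin (m + 1) →ᵇᵃ[I] ℝ := BoxAdditiveMap.upperSubLower I i
    (fun z J => integral J GP (fun x => F (i.insertNth z x) i) BoxAdditiveMap.volume)
    (sliceIntegral i) fun _ _ _ => rfl
  refine ⟨⟨fun J => ∑ i, A i J, fun J hJ π hπ => ?_⟩, fun J => rfl⟩
  rw [Finset.sum_comm]
  exact Finset.sum_congr rfl fun i _ => (A i).sum_partition_boxes hJ hπ

theorem tendstoUniformlyOn_insertNth {α : Type*} {L : Filter α} {z : α → ℝ} {z₀ : ℝ}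
    (hz : Tendsto z L (𝓝 z₀)) (i : Fin (m + 1)) (s : Set (Fin m → ℝ)) :
    TendstoUniformlyOn (fun a x => (i.insertNth (z a) x : Fin (m + 1) → ℝ))
      (fun x => i.insertNth z₀ x) L s := by
  refine Metric.tendstoUniformlyOn_iff.2 fun ε hε => ?_
  filter_upwards [Metric.tendsto_nhds.1 hz ε hε] with a ha x _
  rwa [Fin.dist_insertNth_insertNth, dist_self, max_eq_left dist_nonneg, dist_comm]

variable {α : Type*} {L : Filter α} {V : α → (Fin (m + 1) → ℝ) → Fin (m + 1) → ℝ}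
  {B : α → Box (Fin (m + 1))}

theorem tendsto_faceIntegral (hV : ∀ a, ContinuousOn (V a) (Box.Icc I))
    (hF : ContinuousOn F (Box.Icc I)) (hlim : TendstoUniformlyOn V F L (Box.Icc I))
    (hB : ∀ a, B a ≤ I) (hlower : Tendsto (fun a => (B a).lower) L (𝓝 I.lower))
    (hupper : Tendsto (fun a => (B a).upper) L (𝓝 I.upper)) (i : Fin (m + 1)) (j : Fin 2) :
    Tendsto (fun a => faceIntegral (V a) (B a) i j) L (𝓝 (faceIntegral F I i j)) := by
  have hmaps (a : α) : MapsTo (fun x => (i.insertNth (endpoint (B a) i j) x : Fin (m + 1) → ℝ))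
      (Box.Icc (I.face i)) (Box.Icc I) :=
    I.mapsTo_insertNth_face_Icc (endpoint_mem_of_le (hB a) i j)
  have hmaps₀ : MapsTo (fun x => (i.insertNth (endpoint I i j) x : Fin (m + 1) → ℝ))
      (Box.Icc (I.face i)) (Box.Icc I) := I.mapsTo_insertNth_face_Icc (endpoint_mem I i j)
  have hlower' := tendsto_pi_nhds.1 hlower
  have hupper' := tendsto_pi_nhds.1 hupper
  have hend : Tendsto (fun a => endpoint (B a) i j) L (𝓝 (endpoint I i j)) := by
    fin_cases j
    exacts [hlower' i, hupper' i]
  have hslice := (Pi.uniformContinuous_proj (fun _ => ℝ) i).comp_tendstoUniformlyOn <|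
    tendstoUniformlyOn_comp hlim (I.isCompact_Icc.uniformContinuousOn_of_continuous hF)
      (tendstoUniformlyOn_insertNth hend i _) hmaps hmaps₀
  obtain ⟨M, hM⟩ := I.isCompact_Icc.exists_bound_of_continuousOn hF
  exact tendsto_integral_of_tendstoUniformlyOn
    (fun a => integrable_face (hV a) i (endpoint_mem_of_le (hB a) i j) GP)
    (integrable_face hF i (endpoint_mem I i j) GP)
    (fun x hx => (norm_le_pi_norm _ i).trans (hM _ (hmaps₀ hx))) hslice
    (fun a => Box.face_mono (hB a) i) (tendsto_pi_nhds.2 fun _ => hlower' _)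
    (tendsto_pi_nhds.2 fun _ => hupper' _)

theorem tendsto_flux (hV : ∀ a, ContinuousOn (V a) (Box.Icc I))
    (hF : ContinuousOn F (Box.Icc I)) (hlim : TendstoUniformlyOn V F L (Box.Icc I))
    (hB : ∀ a, B a ≤ I) (hlower : Tendsto (fun a => (B a).lower) L (𝓝 I.lower))
    (hupper : Tendsto (fun a => (B a).upper) L (𝓝 I.upper)) :
    Tendsto (fun a => flux (V a) (B a)) L (𝓝 (flux F I)) :=
  tendsto_finsetSum _ fun i _ => (tendsto_faceIntegral hV hF hlim hB hlower hupper i 1).sub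
    (tendsto_faceIntegral hV hF hlim hB hlower hupper i 0)

end Flux

section BoxDeriv

variable {ι E : Type*} [Fintype ι] [NormedAddCommGroup E] [NormedSpace ℝ E]

/-- The box function `A` has derivative `d` at `p` within `I`: the ratio of `A J` to the volume of
`J` tends to `d` along the subboxes `J` of `I` that contain `p` in their closure, shrink to `p` and
have bounded distortion. This is the notion of derivative for which the Henstock integral of the
derivative of an additive box function recovers the function. -/
def HasBoxDerivWithinAt (A : Box ι → E) (d : E) (I : Box ι) (p : ι → ℝ) : Prop :=
  ∀ (c : ℝ≥0), ∀ ε > 0, ∃ δ > 0, ∀ J ≤ I, Box.Icc J ⊆ Metric.closedBall p δ → p ∈ Box.Icc J →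
    J.distortion ≤ c →
      ‖volume.real (J : Set (ι → ℝ)) • d - A J‖ ≤ ε * volume.real (J : Set (ι → ℝ))

variable {A B : Box ι → E} {d : E} {I J : Box ι} {p : ι → ℝ}

theorem HasBoxDerivWithinAt.mono (h : HasBoxDerivWithinAt A d I p) (hJ : J ≤ I) :
    HasBoxDerivWithinAt A d J p := fun c ε hε => by
  obtain ⟨δ, hδ, H⟩ := h c ε hε
  exact ⟨δ, hδ, fun K hK => H K (hK.trans hJ)⟩

theorem HasBoxDerivWithinAt.congr_of_mem_nhds (h : HasBoxDerivWithinAt A d I p)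
    {s : Set (ι → ℝ)} (hs : s ∈ 𝓝 p) (hB : ∀ J ≤ I, Box.Icc J ⊆ s → B J = A J) :
    HasBoxDerivWithinAt B d I p := fun c ε hε => by
  obtain ⟨δ₁, hδ₁, H⟩ := h c ε hε
  obtain ⟨δ₂, hδ₂, hball⟩ := Metric.nhds_basis_closedBall.mem_iff.1 hs
  refine ⟨min δ₁ δ₂, lt_min hδ₁ hδ₂, fun J hJ hJp => ?_⟩
  rw [hB J hJ (hJp.trans ((Metric.closedBall_subset_closedBall (min_le_right _ _)).trans hball))]
  exact H J hJ (hJp.trans (Metric.closedBall_subset_closedBall (min_le_left _ _)))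

theorem hasIntegral_of_hasBoxDerivWithinAt {g : (ι → ℝ) → E} (A : ι →ᵇᵃ[I] E)
    (h : ∀ p ∈ Box.Icc I, HasBoxDerivWithinAt A (g p) I p) :
    HasIntegral I GP g BoxAdditiveMap.volume (A I) := by
  refine HasIntegral.of_le_Henstock_of_forall_isLittleO gp_le
    ((volume : Measure (ι → ℝ)).toBoxAdditive.restrict _ le_top)
    (fun _ => ENNReal.toReal_nonneg) A ∅ countable_empty (fun _ _ hx => hx.2.elim) ?_
  intro c p hp ε hε
  obtain ⟨δ, hδ, H⟩ := h p hp.1 c ε hε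
  refine ⟨δ, hδ, fun J hJ hJp hpJ hc => ?_⟩
  rw [dist_eq_norm, BoxAdditiveMap.volume_apply, ← volume_real_box]
  exact H J hJ hJp hpJ (hc rfl)

end BoxDeriv

section Divergence

variable {m : ℕ} {F : (Fin (m + 1) → ℝ) → Fin (m + 1) → ℝ} {I : Box (Fin (m + 1))}
  {p : Fin (m + 1) → ℝ}

theorem hasBoxDerivWithinAt_flux {F' : (Fin (m + 1) → ℝ) →L[ℝ] Fin (m + 1) → ℝ}
    (hF : ContinuousOn F (Box.Icc I)) (hd : HasFDerivWithinAt F F' (Box.Icc I) p) :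
    HasBoxDerivWithinAt (flux F) (∑ i, F' (Pi.single i 1) i) I p := by
  intro c ε hε
  obtain ⟨ε', hε', hlt⟩ := exists_pos_mul_lt hε ((m + 1) * (2 * c))
  obtain ⟨δ, hδ, H⟩ := (nhdsWithin_hasBasis Metric.nhds_basis_closedBall _).mem_iff.1
    (hd.isLittleO.def hε')
  refine ⟨δ, hδ, fun J hJ hJp hpJ hc => ?_⟩
  have hJI : Box.Icc J ⊆ Box.Icc I := Box.le_iff_Icc.1 hJ
  have component_le (i : Fin (m + 1)) : ‖volume.real (J : Set (Fin (m + 1) → ℝ)) •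
      F' (Pi.single i 1) i - (faceIntegral F J i 1 - faceIntegral F J i 0)‖ ≤
        2 * ε' * c * volume.real (J : Set (Fin (m + 1) → ℝ)) := by
    rw [volume_real_box]
    exact norm_volume_sub_integral_face_upper_sub_lower_smul_le J (f := fun y => F y i)
      (f' := (ContinuousLinearMap.proj i).comp F') (a := F p i)
      ((continuous_apply i).comp_continuousOn (hF.mono hJI)) hpJ hε'
      (fun y hy => (norm_le_pi_norm (F y - F p - F' (y - p)) i).trans (H ⟨hJp hy, hJI hy⟩)) hc
  rw [flux, Finset.smul_sum, ← Finset.sum_sub_distrib]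
  calc _ ≤ ∑ _i : Fin (m + 1), 2 * ε' * c * volume.real (J : Set (Fin (m + 1) → ℝ)) :=
        norm_sum_le_of_le _ fun i _ => component_le i
    _ = (m + 1) * (2 * c) * ε' * volume.real (J : Set (Fin (m + 1) → ℝ)) := by
        rw [Finset.sum_const, Finset.card_fin, nsmul_eq_mul]
        push_cast
        ring
    _ ≤ ε * volume.real (J : Set (Fin (m + 1) → ℝ)) :=
        mul_le_mul_of_nonneg_right hlt.le (volume_real_box_pos J).le

theorem flux_eq_of_hasBoxDerivWithinAt {g : (Fin (m + 1) → ℝ) → ℝ} {y : ℝ}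
    (hF : ContinuousOn F (Box.Icc I)) (hg : HasIntegral I Riemann g BoxAdditiveMap.volume y)
    (hd : ∀ p ∈ Box.Ioo I, HasBoxDerivWithinAt (flux F) (g p) I p) : flux F I = y := by
  obtain ⟨B, hBIoo, hlower, hupper⟩ := I.exists_seq_mono_tendsto
  have hBIcc (k : ℕ) : Box.Icc (B k) ⊆ Box.Icc I := (hBIoo k).trans I.Ioo_subset_Icc
  have hBI (k : ℕ) : B k ≤ I := Box.le_iff_Icc.2 (hBIcc k)
  have flux_eq_integral (k : ℕ) :
      flux F (B k) = integral (B k) Riemann g BoxAdditiveMap.volume := by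
    obtain ⟨A, hA⟩ := exists_boxAdditiveMap_eq_flux (hF.mono (hBIcc k))
    have hGP : HasIntegral (B k) GP g BoxAdditiveMap.volume (A (B k)) :=
      hasIntegral_of_hasBoxDerivWithinAt A fun p hp => by
        rw [show (A : Box (Fin (m + 1)) → ℝ) = flux F from funext hA]
        exact (hd p (hBIoo k hp)).mono (hBI k)
    rw [← hA]
    exact hGP.unique ((hg.integrable.to_subbox (hBI k)).hasIntegral.mono bot_le)
  obtain ⟨M, hM⟩ := exists_norm_le_of_integrable_Riemann hg.integrable
  have flux_tendsto : Tendsto (fun k => flux F (B k)) atTop (𝓝 (flux F I)) :=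
    tendsto_flux (fun _ => hF) hF (fun u hu => .of_forall fun _ _ _ => refl_mem_uniformity hu) hBI
      hlower hupper
  have integral_tendsto := tendsto_integral_subbox hg.integrable hM hBI hlower hupper
  rw [hg.integral_eq] at integral_tendsto
  exact tendsto_nhds_unique flux_tendsto (integral_tendsto.congr fun k => (flux_eq_integral k).symm)

end Divergence

theorem tendstoUniformlyOn_comp_of_continuous {α β γ δ : Type*} [UniformSpace γ] [UniformSpace δ]
    {L : Filter α} {F : α → β → γ} {f : β → γ} {s : Set β} {Φ : γ → δ} (hΦ : Continuous Φ)
    (hF : TendstoUniformlyOn F f L s) (hs : IsCompact (f '' s)) :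
    TendstoUniformlyOn (fun a => Φ ∘ F a) (Φ ∘ f) L s := fun u hu => by
  have := hs.uniformContinuousAt_of_continuousAt Φ (fun _ _ => hΦ.continuousAt) hu
  filter_upwards [hF _ this] with a ha x hx
  exact ha x hx (mem_image_of_mem f hx)

theorem hasFDerivWithinAt_clm_apply_of_eq_zero {V X Y : Type*} [NormedAddCommGroup V]
    [NormedSpace ℝ V] [NormedAddCommGroup X] [NormedSpace ℝ X] [NormedAddCommGroup Y]
    [NormedSpace ℝ Y] {T : V → X →L[ℝ] Y} {u : V → X} {u' : V →L[ℝ] X} {s : Set V} {p : V}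
    (hT : ContinuousWithinAt T s p) (hu : HasFDerivWithinAt u u' s p) (hp : u p = 0) :
    HasFDerivWithinAt (fun t => T t (u t)) (T p ∘L u') s p := by
  have hu_isBigO : u =O[𝓝[s] p] fun t => t - p := by simpa [hp] using hu.isBigO_sub
  have hT_isLittleO : (fun t => T t - T p) =o[𝓝[s] p] fun _ => (1 : ℝ) :=
    (Asymptotics.isLittleO_one_iff ℝ).2 (tendsto_sub_nhds_zero_iff.2 hT)
  have hprod : (fun t => (T t - T p) (u t)) =o[𝓝[s] p] fun t => t - p := by
    have := (hT_isLittleO.norm_left.mul_isBigO hu_isBigO.norm_norm).congr_right fun _ => one_mul _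
    exact ((Asymptotics.isBigO_of_le _ fun t => by
      simpa using (T t - T p).le_opNorm (u t)).trans_isLittleO this).of_norm_right
  refine .of_isLittleO <| (hprod.add
    ((T p).hasFDerivAt.comp_hasFDerivWithinAt p hu).isLittleO).congr_left fun t => ?_
  simp [hp]

section Approximation

variable {V E : Type*} [NormedAddCommGroup V] [NormedSpace ℝ V] [FiniteDimensional ℝ V]
  [NormedAddCommGroup E] [NormedSpace ℝ E]

theorem exists_contDiff_dist_fderiv_le [CompleteSpace E] {g : V → E} (hg : ContDiff ℝ 1 g)
    (hc : HasCompactSupport g) (n : ℕ∞) {ε : ℝ} (hε : 0 < ε) :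
    ∃ h : V → E, ContDiff ℝ n h ∧ ∀ t, dist (fderiv ℝ g t) (fderiv ℝ h t) ≤ ε := by
  borelize V
  let μ : Measure V := Measure.addHaar
  have hcont : Continuous (fderiv ℝ g) := hg.continuous_fderiv one_ne_zero
  obtain ⟨δ, hδ, H⟩ := Metric.uniformContinuous_iff_le.1
    ((hc.fderiv ℝ).uniformContinuous_of_continuous hcont) ε hε
  let φ : ContDiffBump (0 : V) := ⟨δ / 2, δ, half_pos hδ, half_lt_self hδ⟩
  refine ⟨φ.normed μ ⋆[ContinuousLinearMap.lsmul ℝ ℝ, μ] g,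
    φ.hasCompactSupport_normed.contDiff_convolution_left _ φ.contDiff_normed
      hg.continuous.locallyIntegrable, fun t => ?_⟩
  have hfderiv : HasFDerivAt (φ.normed μ ⋆[ContinuousLinearMap.lsmul ℝ ℝ, μ] g) _ t :=
    hc.hasFDerivAt_convolution_right _ φ.continuous_normed.locallyIntegrable hg t
  have hprecompR : (ContinuousLinearMap.lsmul ℝ ℝ : ℝ →L[ℝ] E →L[ℝ] E).precompR V =
      ContinuousLinearMap.lsmul ℝ ℝ := by
    ext
    simp
  rw [hfderiv.fderiv, hprecompR, dist_comm]
  exact φ.dist_normed_convolution_le hcont.aestronglyMeasurable fun x hx => H hx.le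

theorem exists_contDiff_tendstoUniformly_fderiv [CompleteSpace E] {g : V → E}
    (hg : ContDiff ℝ 1 g) (hc : HasCompactSupport g) (n : ℕ∞) :
    ∃ h : ℕ → V → E, (∀ k, ContDiff ℝ n (h k)) ∧
      TendstoUniformly (fun k => fderiv ℝ (h k)) (fderiv ℝ g) atTop := by
  obtain ⟨ε, -, hε, hε₀⟩ := exists_seq_strictAnti_tendsto (0 : ℝ)
  choose h hh hdist using fun k => exists_contDiff_dist_fderiv_le hg hc n (hε k)
  refine ⟨h, hh, Metric.tendstoUniformly_iff.2 fun δ hδ => ?_⟩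
  filter_upwards [hε₀.eventually_lt_const hδ] with k hk t
  exact (hdist k t).trans_lt hk

theorem exists_contDiff_hasCompactSupport_eventuallyEq {c : V → E} {K s : Set V}
    (hK : IsCompact K) (hc : ContDiffOn ℝ 1 c s) (hKs : K ⊆ interior s) :
    ∃ g : V → E, ContDiff ℝ 1 g ∧ HasCompactSupport g ∧ g =ᶠ[𝓝ˢ K] c := by
  obtain ⟨K', hK', hKK', hK's⟩ := exists_compact_between hK isOpen_interior hKs
  obtain ⟨χ, hχ_one, hχ_zero, -⟩ := exists_contMDiffMap_one_nhds_of_subset_interior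
    (n := 1) 𝓘(ℝ, V) hK.isClosed hKK'
  have hχ : ContDiff ℝ 1 χ := χ.contMDiff.contDiff
  have hzero : ∀ t ∉ K', χ t • c t = 0 := fun t ht => by rw [hχ_zero t ht, zero_smul]
  refine ⟨fun t => χ t • c t, contDiff_iff_contDiffAt.2 fun t => ?_,
    HasCompactSupport.intro hK' hzero, hχ_one.mono fun t ht => by simp [ht]⟩
  by_cases ht : t ∈ K'
  · exact hχ.contDiffAt.smul (hc.contDiffAt (mem_interior_iff_mem_nhds.1 (hK's ht)))
  · exact contDiffAt_const.congr_of_eventuallyEq <|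
      Filter.mem_of_superset (hK'.isClosed.isOpen_compl.mem_nhds ht) hzero

end Approximation

section Pullback

variable {V E G : Type*} [NormedAddCommGroup V] [NormedSpace ℝ V] [NormedAddCommGroup E]
  [NormedSpace ℝ E] [NormedAddCommGroup G] [NormedSpace ℝ G] {k : ℕ}

/-- The pullback of a `k`-form by a map defined on `s`, at a point of `s`; the differential of the
map is taken within `s`. -/
def pullbackWithin (ω : E → E [⋀^Fin k]→L[ℝ] G) (c : V → E) (s : Set V) (t : V) :
    V [⋀^Fin k]→L[ℝ] G :=
  (ω (c t)).compContinuousLinearMap (fderivWithin ℝ c s t)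

variable {ω : E → E [⋀^Fin k]→L[ℝ] G} {c g : V → E} {s : Set V} {p : V}

theorem pullbackWithin_sub (ω η : E → E [⋀^Fin k]→L[ℝ] G) (c : V → E) (s : Set V) :
    pullbackWithin (ω - η) c s = pullbackWithin ω c s - pullbackWithin η c s := rfl

theorem pullbackWithin_univ_eq_of_eventuallyEq (hs : s ∈ 𝓝 p) (h : g =ᶠ[𝓝 p] c) :
    pullbackWithin ω g univ p = pullbackWithin ω c s p := by
  rw [pullbackWithin, pullbackWithin, fderivWithin_univ, fderivWithin_of_mem_nhds hs,
    h.fderiv_eq, h.eq_of_nhds]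

theorem continuousOn_pullbackWithin (hω : ContinuousOn ω (c '' s)) (hc : ContDiffOn ℝ 1 c s)
    (hs : UniqueDiffOn ℝ s) : ContinuousOn (pullbackWithin ω c s) s :=
  (ContinuousAlternatingMap.continuous_compContinuousLinearMapCLM.comp_continuousOn
    (hc.continuousOn_fderivWithin hs le_rfl)).clm_apply (hω.comp hc.continuousOn (mapsTo_image _ _))

theorem alternatizeUncurryFin_compContinuousLinearMap (A : V →L[ℝ] E)
    (P : E →L[ℝ] E [⋀^Fin k]→L[ℝ] G) :
    (ContinuousAlternatingMap.alternatizeUncurryFin P).compContinuousLinearMap A =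
      ContinuousAlternatingMap.alternatizeUncurryFin
        (ContinuousAlternatingMap.compContinuousLinearMapCLM A ∘L P ∘L A) := by
  ext v
  rw [ContinuousAlternatingMap.compContinuousLinearMap_apply,
    ContinuousAlternatingMap.alternatizeUncurryFin_apply,
    ContinuousAlternatingMap.alternatizeUncurryFin_apply]
  rfl

theorem hasFDerivWithinAt_pullbackWithin_of_eq_zero {ω' : E →L[ℝ] E [⋀^Fin k]→L[ℝ] G}
    (hω : HasFDerivAt ω ω' (c p)) (hp : ω (c p) = 0) (hc : DifferentiableWithinAt ℝ c s p)
    (hc' : ContinuousWithinAt (fderivWithin ℝ c s) s p) :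
    HasFDerivWithinAt (pullbackWithin ω c s) (ContinuousAlternatingMap.compContinuousLinearMapCLM
      (fderivWithin ℝ c s p) ∘L ω' ∘L fderivWithin ℝ c s p) s p :=
  hasFDerivWithinAt_clm_apply_of_eq_zero
    (ContinuousAlternatingMap.continuous_compContinuousLinearMapCLM.continuousAt
      |>.comp_continuousWithinAt hc')
    (hω.comp_hasFDerivWithinAt p hc.hasFDerivWithinAt) hp

end Pullback

section FormVector

variable {m : ℕ} {E : Type*} [NormedAddCommGroup E] [NormedSpace ℝ E]

/-- The vector corresponding to an `m`-covector `P` on `ℝ^(m + 1)`, that is the `v` such that `P` is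
the interior product of `v` with `dx⁰ ∧ ⋯ ∧ dxᵐ`. It turns exterior derivatives into divergences. -/
def formVector (m : ℕ) : ((Fin (m + 1) → ℝ) [⋀^Fin m]→L[ℝ] ℝ) →L[ℝ] Fin (m + 1) → ℝ :=
  ContinuousLinearMap.pi fun i => (-1 : ℝ) ^ (i : ℕ) •
    ContinuousAlternatingMap.apply ℝ (Fin (m + 1) → ℝ) ℝ
      (i.removeNth fun l : Fin (m + 1) => (Pi.single l 1 : Fin (m + 1) → ℝ))

theorem formVector_apply (P : (Fin (m + 1) → ℝ) [⋀^Fin m]→L[ℝ] ℝ) (i : Fin (m + 1)) :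
    formVector m P i = (-1 : ℝ) ^ (i : ℕ) *
      P fun l => (Pi.single (i.succAbove l) 1 : Fin (m + 1) → ℝ) := rfl

theorem sum_formVector_comp_apply
    (P' : (Fin (m + 1) → ℝ) →L[ℝ] (Fin (m + 1) → ℝ) [⋀^Fin m]→L[ℝ] ℝ) :
    ∑ i, (formVector m ∘L P') (Pi.single i 1) i =
      ContinuousAlternatingMap.alternatizeUncurryFin P' fun i => Pi.single i 1 := by
  rw [ContinuousAlternatingMap.alternatizeUncurryFin_apply]
  refine Finset.sum_congr rfl fun i _ => ?_
  rw [ContinuousLinearMap.comp_apply, formVector_apply, zsmul_eq_mul]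
  push_cast
  rfl

variable {ω : E → E [⋀^Fin m]→L[ℝ] ℝ} {c g : (Fin (m + 1) → ℝ) → E} {s : Set (Fin (m + 1) → ℝ)}
  {I J : Box (Fin (m + 1))} {p : Fin (m + 1) → ℝ}

theorem uniqueDiffOn_box_Icc {ι : Type*} [Finite ι] (I : Box ι) : UniqueDiffOn ℝ (Box.Icc I) := by
  rw [Box.Icc_eq_pi]
  exact UniqueDiffOn.univ_pi fun i => uniqueDiffOn_Icc (I.lower_lt_upper i)

theorem isOpen_box_Ioo {ι : Type*} [Finite ι] (I : Box ι) : IsOpen (Box.Ioo I) :=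
  isOpen_set_pi finite_univ fun _ _ => isOpen_Ioo

theorem continuousOn_formVector_pullbackWithin (hω : ContinuousOn ω (c '' Box.Icc I))
    (hc : ContDiffOn ℝ 1 c (Box.Icc I)) :
    ContinuousOn (formVector m ∘ pullbackWithin ω c (Box.Icc I)) (Box.Icc I) :=
  (formVector m).continuous.comp_continuousOn
    (continuousOn_pullbackWithin hω hc (uniqueDiffOn_box_Icc I))

theorem hasBoxDerivWithinAt_flux_pullbackWithin_of_eq_zero (hω : ContinuousOn ω (c '' Box.Icc I))
    (hc : ContDiffOn ℝ 1 c (Box.Icc I)) (hp : p ∈ Box.Icc I) (hd : DifferentiableAt ℝ ω (c p))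
    (hωp : ω (c p) = 0) :
    HasBoxDerivWithinAt (flux (formVector m ∘ pullbackWithin ω c (Box.Icc I)))
      (pullbackWithin (extDeriv ω) c (Box.Icc I) p fun i => Pi.single i 1) I p := by
  have hpullback := hasFDerivWithinAt_pullbackWithin_of_eq_zero hd.hasFDerivAt hωp
    (hc.differentiableOn one_ne_zero p hp)
    (hc.continuousOn_fderivWithin (uniqueDiffOn_box_Icc I) le_rfl p hp)
  rw [pullbackWithin, extDeriv, alternatizeUncurryFin_compContinuousLinearMap,
    ← sum_formVector_comp_apply]
  exact hasBoxDerivWithinAt_flux (continuousOn_formVector_pullbackWithin hω hc)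
    ((formVector m).hasFDerivAt.comp_hasFDerivWithinAt p hpullback)

theorem flux_pullbackWithin_const_eq_zero_of_contDiff_two (η : E [⋀^Fin m]→L[ℝ] ℝ)
    (hg : ContDiff ℝ 2 g) (J : Box (Fin (m + 1))) :
    flux (formVector m ∘ pullbackWithin (fun _ => η) g univ) J = 0 := by
  have hdiff : Differentiable ℝ fun t => η.compContinuousLinearMap (fderiv ℝ g t) := fun t =>
    (differentiableAt_const η).continuousAlternatingMapCompContinuousLinearMap
      ((hg.fderiv_right (m := 1) (by norm_num)).differentiable one_ne_zero t)
  have extDeriv_eq_zero (t) :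
      extDeriv (fun t => η.compContinuousLinearMap (fderiv ℝ g t)) t = 0 := by
    have extDeriv_const : extDeriv (fun _ : E => η) (g t) = 0 := by
      rw [extDeriv, fderiv_fun_const]
      exact map_zero (ContinuousAlternatingMap.alternatizeUncurryFinCLM ℝ E ℝ)
    rw [extDeriv_pullback (ω := fun _ => η) (r := 2) (differentiableAt_const η) hg.contDiffAt
      (by simp), extDeriv_const]
    rfl
  simp only [Function.comp_def, pullbackWithin, fderivWithin_univ]
  refine flux_eq_of_hasBoxDerivWithinAt (g := 0)
    ((formVector m).continuous.comp hdiff.continuous).continuousOn hasIntegral_zero fun t _ => ?_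
  have := hasBoxDerivWithinAt_flux (I := J)
    ((formVector m).continuous.comp hdiff.continuous).continuousOn
    ((formVector m).hasFDerivAt.comp t (hdiff t).hasFDerivAt).hasFDerivWithinAt
  rwa [sum_formVector_comp_apply, ← extDeriv, extDeriv_eq_zero] at this

variable [CompleteSpace E]

theorem flux_pullbackWithin_const_eq_zero_of_hasCompactSupport (η : E [⋀^Fin m]→L[ℝ] ℝ)
    (hg : ContDiff ℝ 1 g) (hc : HasCompactSupport g) (J : Box (Fin (m + 1))) :
    flux (formVector m ∘ pullbackWithin (fun _ => η) g univ) J = 0 := by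
  obtain ⟨h, hh, hlim⟩ := exists_contDiff_tendstoUniformly_fderiv hg hc 2
  let Φ (A : (Fin (m + 1) → ℝ) →L[ℝ] E) : Fin (m + 1) → ℝ :=
    formVector m (η.compContinuousLinearMap A)
  have hΦ : Continuous Φ := (formVector m).continuous.comp
    (ContinuousAlternatingMap.continuous_compContinuousLinearMapCLM.clm_apply
      (continuous_const (y := η)))
  have eq_comp (f : (Fin (m + 1) → ℝ) → E) :
      formVector m ∘ pullbackWithin (fun _ => η) f univ = Φ ∘ fderiv ℝ f := by
    rw [← fderivWithin_univ]
    rfl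
  have hcont := hg.continuous_fderiv one_ne_zero
  have hΦlim := tendstoUniformlyOn_comp_of_continuous hΦ
    (hlim.tendstoUniformlyOn (s := Box.Icc J)) (J.isCompact_Icc.image hcont)
  have flux_tendsto := tendsto_flux (B := fun _ => J)
    (fun k => (hΦ.comp ((hh k).continuous_fderiv two_ne_zero)).continuousOn)
    (hΦ.comp hcont).continuousOn hΦlim (fun _ => le_rfl) tendsto_const_nhds tendsto_const_nhds
  have flux_eq_zero (k : ℕ) : flux (Φ ∘ fderiv ℝ (h k)) J = 0 := by
    rw [← eq_comp]
    exact flux_pullbackWithin_const_eq_zero_of_contDiff_two η (hh k) J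
  rw [eq_comp]
  exact tendsto_nhds_unique flux_tendsto (tendsto_const_nhds.congr fun k => (flux_eq_zero k).symm)

theorem flux_pullbackWithin_const_eq_zero (η : E [⋀^Fin m]→L[ℝ] ℝ) (hc : ContDiffOn ℝ 1 c s)
    (hJ : Box.Icc J ⊆ interior s) :
    flux (formVector m ∘ pullbackWithin (fun _ => η) c s) J = 0 := by
  obtain ⟨g, hg, hgc, heq⟩ :=
    exists_contDiff_hasCompactSupport_eventuallyEq J.isCompact_Icc hc hJ
  rw [← flux_pullbackWithin_const_eq_zero_of_hasCompactSupport η hg hgc J]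
  exact flux_congr fun t ht => congrArg (formVector m)
    (pullbackWithin_univ_eq_of_eventuallyEq (mem_interior_iff_mem_nhds.1 (hJ ht))
      (heq.filter_mono (nhds_le_nhdsSet ht))).symm

theorem hasBoxDerivWithinAt_flux_pullbackWithin (hω : ContinuousOn ω (c '' Box.Icc I))
    (hc : ContDiffOn ℝ 1 c (Box.Icc I)) (hp : p ∈ Box.Ioo I) (hd : DifferentiableAt ℝ ω (c p)) :
    HasBoxDerivWithinAt (flux (formVector m ∘ pullbackWithin ω c (Box.Icc I)))
      (pullbackWithin (extDeriv ω) c (Box.Icc I) p fun i => Pi.single i 1) I p := by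
  let η : E → E [⋀^Fin m]→L[ℝ] ℝ := fun _ => ω (c p)
  have hη : ContinuousOn η (c '' Box.Icc I) := continuousOn_const
  have extDeriv_sub_const : extDeriv (ω - η) (c p) = extDeriv ω (c p) := by
    rw [extDeriv, extDeriv, show ω - η = fun x => ω x - ω (c p) from rfl, fderiv_sub_const]
  have hsub := hasBoxDerivWithinAt_flux_pullbackWithin_of_eq_zero (hω.sub hη) hc
    (I.Ioo_subset_Icc hp) (hd.sub_const _) (sub_self _)
  rw [pullbackWithin, extDeriv_sub_const] at hsub
  refine hsub.congr_of_mem_nhds ((isOpen_box_Ioo I).mem_nhds hp) fun J hJ hJIoo => ?_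
  have hJI := Box.le_iff_Icc.1 hJ
  have hfield : formVector m ∘ pullbackWithin (ω - η) c (Box.Icc I) =
      formVector m ∘ pullbackWithin ω c (Box.Icc I) -
        formVector m ∘ pullbackWithin η c (Box.Icc I) := by
    rw [pullbackWithin_sub]
    exact funext fun t => map_sub (formVector m) _ _
  rw [hfield, flux_sub ((continuousOn_formVector_pullbackWithin hω hc).mono hJI)
      ((continuousOn_formVector_pullbackWithin hη hc).mono hJI),
    flux_pullbackWithin_const_eq_zero _ hc
      (hJIoo.trans (interior_maximal I.Ioo_subset_Icc (isOpen_box_Ioo I))), sub_zero]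

theorem flux_pullbackWithin_eq_of_hasIntegral {f : (Fin (m + 1) → ℝ) → ℝ} {y : ℝ}
    (hω : ContinuousOn ω (c '' Box.Icc I)) (hc : ContDiffOn ℝ 1 c (Box.Icc I))
    (hd : ∀ p ∈ Box.Ioo I, DifferentiableAt ℝ ω (c p))
    (hf : ∀ p ∈ Box.Ioo I,
      f p = pullbackWithin (extDeriv ω) c (Box.Icc I) p fun i => Pi.single i 1)
    (hy : HasIntegral I Riemann f BoxAdditiveMap.volume y) :
    flux (formVector m ∘ pullbackWithin ω c (Box.Icc I)) I = y := by
  refine flux_eq_of_hasBoxDerivWithinAt (continuousOn_formVector_pullbackWithin hω hc) hy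
    fun p hp => ?_
  rw [hf p hp]
  exact hasBoxDerivWithinAt_flux_pullbackWithin hω hc hp (hd p hp)

end FormVector

section Insert

variable {k : ℕ}

/-- The derivative of `Fin.insertNth i a` as a function of the remaining coordinates. -/
def insertNthDeriv (i : Fin (k + 1)) : (Fin k → ℝ) →L[ℝ] Fin (k + 1) → ℝ :=
  ContinuousLinearMap.pi (i.insertNth 0 fun l => ContinuousLinearMap.proj l)

theorem hasFDerivAt_insertNth (i : Fin (k + 1)) (a : ℝ) (t : Fin k → ℝ) :
    HasFDerivAt (fun t : Fin k → ℝ => (i.insertNth a t : Fin (k + 1) → ℝ))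
      (insertNthDeriv i) t := by
  refine hasFDerivAt_pi.2 fun l => ?_
  cases l using i.succAboveCases with
  | x => simpa using hasFDerivAt_const a t
  | p l => simpa using hasFDerivAt_apply l t

theorem insertNthDeriv_single (i : Fin (k + 1)) (l : Fin k) :
    insertNthDeriv i (Pi.single l 1) = Pi.single (i.succAbove l) 1 := by
  funext j
  cases j using i.succAboveCases with
  | x => simp [insertNthDeriv]
  | p j => simp [insertNthDeriv, Pi.single_apply]

end Insert

theorem IsC1On.contDiffOn {E F : Type*} [NormedAddCommGroup E] [NormedSpace ℝ E]
    [NormedAddCommGroup F] [NormedSpace ℝ F] {f : E → F} {X : Set E} (h : IsC1On f X) :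
    ContDiffOn ℝ 1 f X := by
  intro x hx
  obtain ⟨V, hV, hxV, G, hG, hfG⟩ := h x hx
  rw [← contDiffWithinAt_inter (hV.mem_nhds hxV)]
  exact ((hG x hxV).mono inter_subset_right).congr (fun y hy => hfG y ⟨hy.2, hy.1⟩)
    (hfG x ⟨hxV, hx⟩)

variable {n k : ℕ} {U : Set (EuclideanSpace ℝ (Fin n))}

namespace SingularBlock

variable {c : SingularBlock (k + 1) U} {ω : Form n k}

theorem contDiffOn (c : SingularBlock k U) : ContDiffOn ℝ 1 c.toFun (Box.Icc c.box) :=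
  c.isC1On.contDiffOn

theorem image_face_subset (c : SingularBlock (k + 1) U) (i : Fin (k + 1)) (j : Fin 2) :
    (c.face i j).image ⊆ c.image := by
  rintro _ ⟨t, ht, rfl⟩
  exact ⟨_, (insertNth_mem_Icc_iff c.box i j t).2 ht, rfl⟩

theorem coeff_face (c : SingularBlock (k + 1) U) (ω : Form n k) (i : Fin (k + 1)) (j : Fin 2)
    {t : Fin k → ℝ} (ht : t ∈ Box.Icc (c.face i j).box) :
    (c.face i j).coeff ω t = (-1 : ℝ) ^ (i : ℕ) *
      formVector k (c.pullback ω (i.insertNth (endpoint c.box i j) t)) i := by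
  have hderiv : HasFDerivWithinAt (c.face i j).toFun
      (fderivWithin ℝ c.toFun (Box.Icc c.box) (i.insertNth (endpoint c.box i j) t) ∘L
        insertNthDeriv i) (Box.Icc (c.face i j).box) t :=
    HasFDerivWithinAt.comp t
      (c.contDiffOn.differentiableOn one_ne_zero _
        ((insertNth_mem_Icc_iff c.box i j t).2 ht)).hasFDerivWithinAt
      (hasFDerivAt_insertNth i _ t).hasFDerivWithinAt
      fun s hs => (insertNth_mem_Icc_iff c.box i j s).2 hs
  rw [formVector_apply, ← mul_assoc, ← mul_pow, neg_one_mul, neg_neg, one_pow, one_mul, coeff,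
    pullback, pullback, hderiv.fderivWithin (uniqueDiffOn_box_Icc _ t ht),
    ContinuousAlternatingMap.compContinuousLinearMap_apply,
    ContinuousAlternatingMap.compContinuousLinearMap_apply]
  refine congrArg _ (funext fun l => ?_)
  simp [insertNthDeriv_single]

/-- The integral of a form over a singular block (`0` when it does not exist). -/
def integral (c : SingularBlock k U) (ω : Form n k) : ℝ :=
  BoxIntegral.integral c.box Riemann (c.coeff ω) BoxAdditiveMap.volume

theorem hasIntegral_integral (c : SingularBlock k U) (hω : ContinuousOn ω c.image) :
    c.HasIntegral ω (c.integral ω) :=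
  (integrable_of_continuousOn Riemann
    ((ContinuousAlternatingMap.apply ℝ (Fin k → ℝ) ℝ fun i => Pi.single i 1).continuous
      |>.comp_continuousOn (continuousOn_pullbackWithin hω c.contDiffOn (uniqueDiffOn_box_Icc _)))
    volume).hasIntegral

theorem integral_face (hω : ContinuousOn ω c.image) (i : Fin (k + 1)) (j : Fin 2) :
    (c.face i j).integral ω =
      (-1 : ℝ) ^ (i : ℕ) * faceIntegral (formVector k ∘ c.pullback ω) c.box i j := by
  have hface := (integrable_face (continuousOn_formVector_pullbackWithin hω c.contDiffOn) i
    (endpoint_mem c.box i j) GP).hasIntegral.smul ((-1 : ℝ) ^ (i : ℕ))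
  have hcoeff := ((c.face i j).hasIntegral_integral (hω.mono (c.image_face_subset i j))).mono
    (bot_le : GP ≤ Riemann)
  exact hcoeff.unique ((hasIntegral_congr _ _ (fun t ht => c.coeff_face ω i j ht)
    (fun _ _ => rfl) _).2 hface)

theorem flux_pullback_eq_of_hasInteriorIntegral (hω : ContinuousOn ω c.image)
    (hd : ∀ x ∈ c.interiorImage, DifferentiableAt ℝ ω x) {y : ℝ}
    (hy : c.HasInteriorIntegral (extDeriv ω) y) :
    flux (formVector k ∘ c.pullback ω) c.box = y := by
  obtain ⟨g, hg, hgy⟩ := hy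
  exact flux_pullbackWithin_eq_of_hasIntegral hω c.contDiffOn
    (fun p hp => hd _ (mem_image_of_mem _ hp)) hg hgy

theorem continuousOn_of_mem_support_boundary (hω : ContinuousOn ω c.image) {s : SingularBlock k U}
    (hs : s ∈ c.boundary.support) : ContinuousOn ω s.image := by
  classical
  obtain ⟨i, -, hi⟩ := Finset.mem_biUnion.1 (Finsupp.support_finsetSum hs)
  obtain ⟨j, -, hj⟩ := Finset.mem_biUnion.1 (Finsupp.support_finsetSum hi)
  obtain rfl := Finset.mem_singleton.1 (Finsupp.support_single_subset hj)
  exact hω.mono (c.image_face_subset i j)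

end SingularBlock

namespace Chain

variable {ω : Form n k}

/-- The integral of a form over a chain, as a homomorphism on the group of chains. -/
def integral (ω : Form n k) : Chain k U →+ ℝ :=
  Finsupp.liftAddHom fun s => (AddMonoidHom.mulRight (s.integral ω)).comp (Int.castAddHom ℝ)

theorem integral_single (ω : Form n k) (s : SingularBlock k U) (m : ℤ) :
    integral ω (Finsupp.single s m) = m * s.integral ω := by
  simp [integral]

theorem hasIntegral_integral {c : Chain k U} (h : ∀ s ∈ c.support, ContinuousOn ω s.image) :
    c.HasIntegral ω (integral ω c) :=
  ⟨fun s => s.integral ω, fun s hs => s.hasIntegral_integral (h s hs), rfl⟩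

theorem integral_boundary {c : Chain (k + 1) U} {v : SingularBlock (k + 1) U → ℝ}
    (h : ∀ s ∈ c.support, integral ω s.boundary = v s) :
    integral ω c.boundary = c.sum fun s m => (m : ℝ) * v s := by
  rw [boundary, Finsupp.sum, Finsupp.sum, map_sum]
  refine Finset.sum_congr rfl fun s hs => ?_
  rw [map_zsmul, h s hs, zsmul_eq_mul]

theorem continuousOn_of_mem_support_boundary {c : Chain (k + 1) U}
    (hω : ∀ s ∈ c.support, ContinuousOn ω s.image) {s : SingularBlock k U}
    (hs : s ∈ c.boundary.support) : ContinuousOn ω s.image := by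
  classical
  obtain ⟨b, hb, hsb⟩ := Finset.mem_biUnion.1 (Finsupp.support_finsetSum hs)
  exact b.continuousOn_of_mem_support_boundary (hω b hb) (Finsupp.support_smul hsb)

end Chain

namespace SingularBlock

variable {c : SingularBlock (k + 1) U} {ω : Form n k}

theorem integral_boundary_eq_flux (hω : ContinuousOn ω c.image) :
    Chain.integral ω c.boundary = flux (formVector k ∘ c.pullback ω) c.box := by
  rw [boundary, map_sum]
  refine Finset.sum_congr rfl fun i _ => ?_
  have hsign : (-1 : ℝ) ^ (i : ℕ) * (-1) ^ (i : ℕ) = 1 := by rw [← mul_pow]; norm_num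
  rw [map_sum, Fin.sum_univ_two, Chain.integral_single, Chain.integral_single, integral_face hω,
    integral_face hω]
  push_cast
  simp only [Fin.val_zero, Fin.val_one, pow_succ, add_zero]
  linear_combination (faceIntegral (formVector k ∘ c.pullback ω) c.box i 1 -
    faceIntegral (formVector k ∘ c.pullback ω) c.box i 0) * hsign

theorem integral_boundary (hω : ContinuousOn ω c.image)
    (hd : ∀ x ∈ c.interiorImage, DifferentiableAt ℝ ω x) {y : ℝ}
    (hy : c.HasInteriorIntegral (extDeriv ω) y) : Chain.integral ω c.boundary = y :=
  (integral_boundary_eq_flux hω).trans (flux_pullback_eq_of_hasInteriorIntegral hω hd hy)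

end SingularBlock

end Stokes

end

theorem theorem2 {n k : ℕ} (U : Set (EuclideanSpace ℝ (Fin n))) (hU : IsOpen U)
    (ω : Stokes.Form n k) :
    (∀ c : Stokes.SingularBlock (k + 1) U,
      ContinuousOn ω c.image →
      (∀ x ∈ c.interiorImage, DifferentiableAt ℝ ω x) →
      ∀ y : ℝ, c.HasInteriorIntegral (extDeriv ω) y →
        Stokes.Chain.HasIntegral c.boundary ω y) ∧
    (∀ c : Stokes.Chain (k + 1) U,
      (∀ s ∈ c.support, ContinuousOn ω s.image) →
      (∀ s ∈ c.support, ∀ x ∈ s.interiorImage, DifferentiableAt ℝ ω x) →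
      ∀ y : ℝ, Stokes.Chain.HasInteriorIntegral c (extDeriv ω) y →
        Stokes.Chain.HasIntegral (Stokes.Chain.boundary c) ω y) := by
  refine ⟨fun c hω hd y hy => ?_, fun c hω hd y hy => ?_⟩
  · rw [← Stokes.SingularBlock.integral_boundary hω hd hy]
    exact Stokes.Chain.hasIntegral_integral fun s hs =>
      Stokes.SingularBlock.continuousOn_of_mem_support_boundary hω hs
  · obtain ⟨v, hv, rfl⟩ := hy
    rw [← Stokes.Chain.integral_boundary fun s hs =>
      Stokes.SingularBlock.integral_boundary (hω s hs) (hd s hs) (hv s hs)]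
    exact Stokes.Chain.hasIntegral_integral fun s hs =>
      Stokes.Chain.continuousOn_of_mem_support_boundary hω hs
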